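/- \textbf{Setting.} Curves are continuous maps $\gamma:[0,1]\to\mathbb R^2$. A curve is \emph{of class $H^2$} if it belongs to the Sobolev space $H^2(0,1;\mathbb R^2)$ (so it is $C^1$ on $[0,1]$), and it is \emph{regular} if $\gamma_x(x)\neq 0$ for all $x\in[0,1]$. Its length is $L(\gamma)=\int_0^1|\gamma_x|\,dx$ and, if it is regular, its unit tangent is $\tau=\gamma_x/|\gamma_x|$. A \emph{$3$-network of class $H^2$} is a triple $\Gamma=\{\gamma^1,\gamma^2,\gamma^3\}$ of curves of class $H^2$ with $\gamma^1(0)=\gamma^2(0)=\gamma^3(0)=P^1$ and $\gamma^1(1)=\gamma^2(1)=\gamma^3(1)=P^2$ for some points $P^1,P^2\in\mathbb R^2$. Regular curves of a network are parametrized with constant speed, equal to their length. The curves need not be regular, their lengths may be zero, and they may intersect themselves and each other. A \emph{Theta-network} is a $3$-network of class $H^2$ whose three curves are regular and form angles of $120$ degrees at both junctions: for $i\ne j$ the angle between $\tau^i(x)$ and $\tau^j(x)$ is $2\pi/3$ for $x=0$ and for $x=1$. A \emph{degenerate Theta-network} is a $3$-network of class $H^2$ one of whose curves has length zero while the other two,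 $\gamma$ and $\sigma$ say, are regular (hence are closed curves through $P:=P^1=P^2$) and form at $P$ angles of $120$ and $60$ degrees in pairs. This means, after reversing the orientation of $\sigma$ if necessary, that $\tau_\gamma(0)$ and $\tau_\sigma(0)$ form an angle of $2\pi/3$ and $\{\tau_\gamma(0),\tau_\sigma(0)\}=\{\tau_\gamma(1),\tau_\sigma(1)\}$. For a $3$-network $\Gamma$ of class $H^2$ let $$\overline F(\Gamma)=\begin{cases}\displaystyle\sum_{i=1}^3\Big(\frac1{L(\gamma^i)^3}\int_0^1|\gamma^i_{xx}|^2\,dx+L(\gamma^i)\Big)&\text{if }\Gamma\text{ is a Theta-network},\\[2ex]\text{the same sum over the two regular curves only}&\text{if }\Gamma\text{ is a degenerate Theta-network},\\[1ex]+\infty&\text{otherwise.}\end{cases}$$ \textbf{Corollary (existence of a minimizer of $\overline F$).} There is a $3$-network $\Gamma_{\min}$ of class $H^2$ which is a Theta-network or a degenerate Theta-network and which minimizes $\overline F$ among all $3$-networks of class $H^2$, that is, $\overline F(\Gamma_{\min})\le\overline F(\Gamma)$ for every $3$-network $\Gamma$ of class $H^2$. -/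

import Mathlib

open MeasureTheory Set
open scoped ContDiff

noncomputable section

namespace ThetaNet

/-- The Euclidean plane. -/
abbrev Plane : Type := EuclideanSpace ℝ (Fin 2)

/-- Lebesgue measure on the open unit interval. -/
abbrev unitVol : Measure ℝ := volume.restrict (Ioo (0 : ℝ) 1)

/-- `v` is a weak (distributional) derivative of `u` on `(0,1)`:
`∫ φ' u = - ∫ φ v` for every smooth `φ` with compact support in `(0,1)`. -/
def IsWeakDeriv (u v : ℝ → Plane) : Prop :=
  ∀ φ : ℝ → ℝ, ContDiff ℝ ∞ φ → HasCompactSupport φ → tsupport φ ⊆ Ioo 0 1 →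
    ∫ x, deriv φ x • u x ∂unitVol = - ∫ x, φ x • v x ∂unitVol

/-- `w ∈ L²(0,1)` is a second weak derivative of `u`, the first weak derivative being in
`L²(0,1)` too. -/
def IsSecondWeakDeriv (u w : ℝ → Plane) : Prop :=
  ∃ v : ℝ → Plane, MemLp v 2 unitVol ∧ IsWeakDeriv u v ∧ MemLp w 2 unitVol ∧ IsWeakDeriv v w

/-- The Sobolev class `H²(0,1; ℝ²) = W^{2,2}(0,1; ℝ²)`. -/
def MemH2 (u : ℝ → Plane) : Prop :=
  MemLp u 2 unitVol ∧ ∃ w, IsSecondWeakDeriv u w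

open Classical in
/-- The second weak derivative `u_xx` (unique up to null sets; `0` if there is none). -/
def secondDeriv (u : ℝ → Plane) : ℝ → Plane :=
  if h : ∃ w, IsSecondWeakDeriv u w then h.choose else 0

/-- A parametrized curve `γ : [0,1] → ℝ²` of class `H²`; only the values on `[0,1]` matter, and
`γ` is the continuous representative. -/
def IsH2Curve (γ : ℝ → Plane) : Prop :=
  ContinuousOn γ (Icc 0 1) ∧ MemH2 γ

/-- The velocity `γ_x` on `[0,1]` (one-sided at the endpoints). An `H²` curve is `C¹` on
`[0,1]`. -/
def velocity (γ : ℝ → Plane) (x : ℝ) : Plane := derivWithin γ (Icc 0 1) x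

/-- A regular curve: the velocity does not vanish on `[0,1]`. -/
def IsRegular (γ : ℝ → Plane) : Prop := ∀ x ∈ Icc (0 : ℝ) 1, velocity γ x ≠ 0

/-- The length `L(γ) = ∫₀¹ |γ_x| dx`. -/
def length (γ : ℝ → Plane) : ℝ := ∫ x in (0 : ℝ)..1, ‖velocity γ x‖

/-- The unit tangent vector `τ = γ_x / |γ_x|`. -/
def tangent (γ : ℝ → Plane) (x : ℝ) : Plane := ‖velocity γ x‖⁻¹ • velocity γ x

/-- The penalized elastic energy of a curve parametrized with constant speed:
`L(γ)⁻³ ∫₀¹ |γ_xx|² dx + L(γ)`. -/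
def curveEnergy (γ : ℝ → Plane) : ℝ :=
  1 / length γ ^ 3 * (∫ x in (0 : ℝ)..1, ‖secondDeriv γ x‖ ^ 2) + length γ

/-- A `3`-network of class `H²`: three `H²` curves, all running from the junction `P₁` to the
junction `P₂`. Regular curves are parametrized with constant speed, equal to their length.
Curves need not be regular, lengths may vanish, and curves may intersect each other and
themselves. -/
structure H2Network where
  /-- the three curves -/
  curve : Fin 3 → ℝ → Plane
  /-- first junction -/
  P₁ : Plane
  /-- second junction -/
  P₂ : Plane
  isH2 : ∀ i, IsH2Curve (curve i)
  start_eq : ∀ i, curve i 0 = P₁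
  end_eq : ∀ i, curve i 1 = P₂
  constant_speed : ∀ i, IsRegular (curve i) →
    ∀ x ∈ Icc (0 : ℝ) 1, ‖velocity (curve i) x‖ = length (curve i)

/-- A Theta-network: the curves are regular and form angles of `120` degrees at both
junctions. -/
def H2Network.IsTheta (Γ : H2Network) : Prop :=
  (∀ i, IsRegular (Γ.curve i)) ∧
  ∀ i j, i ≠ j →
    InnerProductGeometry.angle (tangent (Γ.curve i) 0) (tangent (Γ.curve j) 0)
      = 2 * Real.pi / 3 ∧
    InnerProductGeometry.angle (tangent (Γ.curve i) 1) (tangent (Γ.curve j) 1)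
      = 2 * Real.pi / 3

/-- Let `a, a'` and `b, b'` be unit vectors, the directions in which the two ends of a first and
of a second closed curve leave a common point. The four directions are `u, v, -u, -v` where `u`
and `v` form an angle of `120` degrees, so that consecutive ones form angles of `120, 60, 120, 60`
degrees; here `u, v` are the directions of the ends `a, b`, and `-u, -v` those of `a', b'`. -/
def FormAngles (a a' b b' : Plane) : Prop :=
  InnerProductGeometry.angle a b = 2 * Real.pi / 3 ∧ ({a, b} : Set Plane) = {-a', -b'}

/-- A degenerate Theta-network: one curve has length zero, the other two are regular (hence
closed, with a common base point) and form angles of `120` and `60` degrees in pairs there. The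
ends of a closed curve `γ` leave the base point in the directions `τ(0)` and `-τ(1)`. The
disjunction makes the condition independent of the orientations of the two curves. -/
def H2Network.IsDegenerateTheta (Γ : H2Network) : Prop :=
  ∃ i j k : Fin 3, i ≠ j ∧ i ≠ k ∧ j ≠ k ∧
    IsRegular (Γ.curve i) ∧ IsRegular (Γ.curve j) ∧ length (Γ.curve k) = 0 ∧
    (FormAngles (tangent (Γ.curve i) 0) (-tangent (Γ.curve i) 1)
        (tangent (Γ.curve j) 0) (-tangent (Γ.curve j) 1) ∨
     FormAngles (tangent (Γ.curve i) 0) (-tangent (Γ.curve i) 1)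
        (-tangent (Γ.curve j) 1) (tangent (Γ.curve j) 0))

open Classical in
/-- The extended functional: the sum of the energies of the three curves on Theta-networks, the
sum of the energies of the two regular curves on degenerate Theta-networks, and `+∞` on all other
networks. -/
def Fbar (Γ : H2Network) : EReal :=
  if Γ.IsTheta then
    ((∑ i, curveEnergy (Γ.curve i) : ℝ) : EReal)
  else if Γ.IsDegenerateTheta then
    ((∑ i with IsRegular (Γ.curve i), curveEnergy (Γ.curve i) : ℝ) : EReal)
  else ⊤

end ThetaNet

end

/-!
The theorem is proved by the direct method of the calculus of variations. No approximation of
degenerate networks by Theta-networks is needed: the class of Theta-networks and degenerate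
Theta-networks together is closed under limits of bounded energy, the functional is lower
semicontinuous on it, and the class is not empty.

By one-dimensional Sobolev regularity (`ThetaNet.IsH2Curve.exists_primitive`, which rests on the
lemma of du Bois-Reymond), the velocity of an `H²` curve is a primitive of its second weak
derivative. Hence a regular curve of constant speed is described, up to translation, by its length
`L > 0` and its unit tangent `τ(x) = a + ∫₀ˣ w` with `w ∈ L²(0,1)` (`ThetaNet.Arc`). Its energy is
`‖w‖² / L + L`, and its end points differ by `L` times the mean of `τ`.

If the energy is at most `C`, then `L ≤ C` and `‖w‖² ≤ (C - L) L`. So along an ultrafilter, `L`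
and `a` converge, `w` converges weakly in `L²(0,1)`, and `τ(x)` and the mean of `τ` converge because
they depend on `(a, w)` through bounded operators (`ThetaNet.Arc.exists_isLimit`). If `L → 0`, then
`w → 0` and the limit of `τ` is constant. This has three consequences.

* A closed curve cannot have length tending to `0`, as its unit tangent has mean zero. So degenerate
  Theta-networks converge to degenerate Theta-networks (`ThetaNet.exists_le_of_degenerate`).
* Two curves of a Theta-network cannot both have length tending to `0`. For their mean tangents `m`
  and `m'` satisfy `L m = L' m'`, whereas `⟨m, m'⟩` tends to `cos 120° < 0`.
* If exactly one length tends to `0`, the limit tangent `e` of that curve is the same at both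
  junctions, which coincide in the limit. The other two tangents form angles of `120` degrees with
  `e` and with each other at both junctions, so in the plane they are the same pair, up to order, at
  both: the limit is a degenerate Theta-network (`ThetaNet.exists_le_of_theta`).

The class is not empty, since two circular arcs of `240` degrees and their common chord form a
Theta-network (`ThetaNet.energyValues_nonempty`).
-/

namespace ThetaNet

/-! ### Weak derivatives on the unit interval -/

/-- The primitive of `w` on `(0,1)` with value `a` at `0`. Integrating against `unitVol` makes it
constant to the left of `0` and to the right of `1`, hence continuous on all of `ℝ`. -/
noncomputable def primitive (a : Plane) (w : ℝ → Plane) (x : ℝ) : Plane :=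
  a + ∫ s in (0 : ℝ)..x, w s ∂unitVol

lemma primitive_zero (a : Plane) (w : ℝ → Plane) : primitive a w 0 = a := by
  simp [primitive]

lemma continuous_primitive (a : Plane) {w : ℝ → Plane} (hw : Integrable w unitVol) :
    Continuous (primitive a w) :=
  continuous_const.add
    (intervalIntegral.continuous_primitive (fun _ _ => hw.intervalIntegrable) 0)

lemma integrable_unitVol_of_continuous {E : Type*} [NormedAddCommGroup E] {g : ℝ → E}
    (hg : Continuous g) : Integrable g unitVol :=
  (hg.integrableOn_Icc (a := 0) (b := 1)).mono_set Ioo_subset_Icc_self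

lemma memLp_two_of_continuous {g : ℝ → Plane} (hg : Continuous g) : MemLp g 2 unitVol := by
  obtain ⟨C, hC⟩ := isCompact_Icc.exists_bound_of_continuousOn (s := Icc (0 : ℝ) 1) hg.continuousOn
  refine MemLp.of_bound hg.aestronglyMeasurable C ?_
  filter_upwards [ae_restrict_mem measurableSet_Ioo] with x hx
  exact hC x (Ioo_subset_Icc_self hx)

lemma intervalIntegral_unitVol (w : ℝ → Plane) {x : ℝ} (hx : x ∈ Icc (0 : ℝ) 1) :
    ∫ s in (0 : ℝ)..x, w s ∂unitVol = ∫ s in (0 : ℝ)..x, w s := by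
  rw [intervalIntegral.integral_of_le hx.1, intervalIntegral.integral_of_le hx.1,
    integral_Ioc_eq_integral_Ioo, integral_Ioc_eq_integral_Ioo, Measure.restrict_restrict
    measurableSet_Ioo, inter_eq_self_of_subset_left (Ioo_subset_Ioo_right hx.2)]

lemma integral_unitVol {E : Type*} [NormedAddCommGroup E] [NormedSpace ℝ E] (g : ℝ → E) :
    ∫ x, g x ∂unitVol = ∫ x in (0 : ℝ)..1, g x := by
  rw [intervalIntegral.integral_of_le zero_le_one, integral_Ioc_eq_integral_Ioo]

/-- Exchange of the order of integration over the triangle `0 < s ≤ x < 1`. -/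
lemma integral_smul_primitive {g : ℝ → ℝ} (hg : Continuous g) {w : ℝ → Plane}
    (hw : Integrable w unitVol) :
    ∫ x, g x • (∫ s in (0 : ℝ)..x, w s ∂unitVol) ∂unitVol =
      ∫ s, (∫ x in s..1, g x) • w s ∂unitVol := by
  have hS : MeasurableSet {p : ℝ × ℝ | p.2 ≤ p.1} := measurableSet_le measurable_snd measurable_fst
  have hF : Integrable ({p : ℝ × ℝ | p.2 ≤ p.1}.indicator fun p => g p.1 • w p.2)
      (unitVol.prod unitVol) :=
    ((integrable_unitVol_of_continuous hg).smul_prod hw).indicator hS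
  calc ∫ x, g x • (∫ s in (0 : ℝ)..x, w s ∂unitVol) ∂unitVol
      = ∫ x, ∫ s, ({p : ℝ × ℝ | p.2 ≤ p.1}.indicator fun p => g p.1 • w p.2) (x, s)
          ∂unitVol ∂unitVol := by
        refine integral_congr_ae ?_
        filter_upwards [ae_restrict_mem measurableSet_Ioo] with x hx
        rw [intervalIntegral.integral_of_le hx.1.le, ← integral_smul,
          ← integral_indicator measurableSet_Ioc]
        refine integral_congr_ae ?_
        filter_upwards [ae_restrict_mem measurableSet_Ioo] with s hs
        simp only [indicator, mem_Ioc, mem_ofPred_eq, hs.1, true_and]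
    _ = ∫ s, ∫ x, ({p : ℝ × ℝ | p.2 ≤ p.1}.indicator fun p => g p.1 • w p.2) (x, s)
          ∂unitVol ∂unitVol := integral_integral_swap hF
    _ = ∫ s, (∫ x in s..1, g x) • w s ∂unitVol := by
        refine integral_congr_ae ?_
        filter_upwards [ae_restrict_mem measurableSet_Ioo] with s hs
        have h1 : ∀ x, ({p : ℝ × ℝ | p.2 ≤ p.1}.indicator fun p => g p.1 • w p.2) (x, s)
            = (Ici s).indicator g x • w s := by
          intro x
          by_cases h : s ≤ x <;> simp [indicator, h]
        have h2 : Ici s ∩ Ioo 0 1 = Ico s 1 := by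
          ext x
          simp only [mem_inter_iff, mem_Ici, mem_Ioo, mem_Ico]
          exact ⟨fun h => ⟨h.1, h.2.2⟩, fun h => ⟨h.1, hs.1.trans_le h.1, h.2⟩⟩
        simp_rw [h1]
        rw [integral_smul_const, integral_indicator measurableSet_Ici,
          Measure.restrict_restrict measurableSet_Ici, h2, integral_Ico_eq_integral_Ioo,
          intervalIntegral.integral_of_le hs.2.le, integral_Ioc_eq_integral_Ioo]

lemma apply_eq_zero_of_tsupport_subset {φ : ℝ → ℝ} (hs : tsupport φ ⊆ Ioo 0 1) {x : ℝ}
    (hx : x ∉ Ioo (0 : ℝ) 1) : φ x = 0 :=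
  image_eq_zero_of_notMem_tsupport fun h => hx (hs h)

lemma integral_deriv_of_tsupport_subset {φ : ℝ → ℝ} (hφ : ContDiff ℝ ∞ φ)
    (hs : tsupport φ ⊆ Ioo 0 1) (s : ℝ) : ∫ x in s..1, deriv φ x = - φ s := by
  rw [intervalIntegral.integral_deriv_eq_sub
    (fun x _ => (hφ.differentiable (by simp)).differentiableAt)
    ((hφ.continuous_deriv (by simp)).intervalIntegrable _ _),
    apply_eq_zero_of_tsupport_subset hs (x := 1) (by simp), zero_sub]

lemma integrable_smul {g : ℝ → ℝ} (hg : Continuous g) {w : ℝ → Plane}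
    (hw : Integrable w unitVol) : Integrable (fun x => g x • w x) unitVol := by
  obtain ⟨C, hC⟩ := isCompact_Icc.exists_bound_of_continuousOn (s := Icc (0 : ℝ) 1) hg.continuousOn
  refine hw.bdd_smul C hg.aestronglyMeasurable ?_
  filter_upwards [ae_restrict_mem measurableSet_Ioo] with x hx
  exact hC x (Ioo_subset_Icc_self hx)

lemma isWeakDeriv_primitive (a : Plane) {w : ℝ → Plane} (hw : Integrable w unitVol) :
    IsWeakDeriv (primitive a w) w := by
  intro φ hφ _ hs
  have hd : Continuous (deriv φ) := hφ.continuous_deriv (by simp)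
  have h0 : ∫ x, deriv φ x • a ∂unitVol = 0 := by
    rw [integral_smul_const, integral_unitVol, integral_deriv_of_tsupport_subset hφ hs,
      apply_eq_zero_of_tsupport_subset hs (x := 0) (by simp), neg_zero, zero_smul]
  have hc : Continuous fun x => ∫ s in (0 : ℝ)..x, w s ∂unitVol :=
    intervalIntegral.continuous_primitive (fun _ _ => hw.intervalIntegrable) 0
  simp only [primitive, smul_add]
  rw [integral_add (integrable_unitVol_of_continuous (by fun_prop))
    (integrable_smul hd (integrable_unitVol_of_continuous hc)), h0, zero_add,
    integral_smul_primitive hd hw, ← integral_neg]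
  simp_rw [integral_deriv_of_tsupport_subset hφ hs, neg_smul]

lemma ae_eq_zero_of_integral_test {f : ℝ → Plane} (hf : Integrable f unitVol)
    (h : ∀ φ : ℝ → ℝ, ContDiff ℝ ∞ φ → HasCompactSupport φ → tsupport φ ⊆ Ioo 0 1 →
      ∫ x, φ x • f x ∂unitVol = 0) : f =ᵐ[unitVol] 0 := by
  refine (ae_restrict_iff' measurableSet_Ioo).2 ?_
  refine isOpen_Ioo.ae_eq_zero_of_integral_contDiff_smul_eq_zero (μ := volume)
    (IntegrableOn.locallyIntegrableOn hf) fun φ h1 h2 h3 => ?_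
  rw [← h φ h1 h2 h3]
  refine (setIntegral_eq_integral_of_forall_compl_eq_zero fun x hx => ?_).symm
  rw [apply_eq_zero_of_tsupport_subset h3 hx, zero_smul]

lemma IsWeakDeriv.ae_eq {u v v' : ℝ → Plane} (hv : Integrable v unitVol)
    (hv' : Integrable v' unitVol) (h : IsWeakDeriv u v) (h' : IsWeakDeriv u v') :
    v =ᵐ[unitVol] v' := by
  have := ae_eq_zero_of_integral_test (hv.sub hv') fun φ h1 h2 h3 => by
    simp only [Pi.sub_apply, smul_sub]
    rw [integral_sub (integrable_smul h1.continuous hv) (integrable_smul h1.continuous hv'),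
      sub_eq_zero, ← neg_inj, ← h φ h1 h2 h3, ← h' φ h1 h2 h3]
  filter_upwards [this] with x hx
  exact sub_eq_zero.1 hx

/-- A test function with zero mean is the derivative of a test function. -/
lemma exists_test_deriv_eq {φ : ℝ → ℝ} (hφ : ContDiff ℝ ∞ φ)
    (hc : HasCompactSupport φ) (hs : tsupport φ ⊆ Ioo 0 1) (h0 : ∫ x in (0 : ℝ)..1, φ x = 0) :
    ∃ ψ : ℝ → ℝ, ContDiff ℝ ∞ ψ ∧ HasCompactSupport ψ ∧ tsupport ψ ⊆ Ioo 0 1 ∧ deriv ψ = φ := by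
  obtain ⟨a, b, ha, hb, hab⟩ : ∃ a b : ℝ, 0 < a ∧ b < 1 ∧ tsupport φ ⊆ Icc a b := by
    rcases (tsupport φ).eq_empty_or_nonempty with he | hne
    · exact ⟨1 / 2, 1 / 2, by norm_num, by norm_num, by simp [he]⟩
    · have hc' : IsCompact (tsupport φ) := hc
      exact ⟨sInf (tsupport φ), sSup (tsupport φ), (hs (hc'.sInf_mem hne)).1,
        (hs (hc'.sSup_mem hne)).2,
        fun x hx => ⟨csInf_le hc'.bddBelow hx, le_csSup hc'.bddAbove hx⟩⟩
  have hz : ∀ x, x ∉ Icc a b → φ x = 0 :=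
    fun x hx => image_eq_zero_of_notMem_tsupport fun h => hx (hab h)
  have hψd : ∀ x, HasDerivAt (fun x => ∫ t in (0 : ℝ)..x, φ t) (φ x) x := fun x =>
    intervalIntegral.integral_hasDerivAt_right (hφ.continuous.intervalIntegrable _ _)
      (hφ.continuous.stronglyMeasurableAtFilter _ _) hφ.continuous.continuousAt
  have hder : deriv (fun x => ∫ t in (0 : ℝ)..x, φ t) = φ := funext fun x => (hψd x).deriv
  have hsupp : Function.support (fun x => ∫ t in (0 : ℝ)..x, φ t) ⊆ Icc a b := by
    intro x hx
    by_contra hx'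
    refine hx ?_
    rw [mem_Icc, not_and_or, not_le, not_le] at hx'
    rcases hx' with h | h
    · refine (intervalIntegral.integral_congr (g := fun _ => (0 : ℝ)) fun t ht => hz t ?_).trans
        (by simp)
      intro ht'
      have := ht.2.trans (sup_le ha.le h.le)
      rcases le_sup_iff.1 ht.2 with h3 | h3 <;> linarith [ht'.1]
    · have h2 : ∫ t in x..1, φ t = 0 := by
        refine (intervalIntegral.integral_congr (g := fun _ => (0 : ℝ)) fun t ht => hz t ?_).trans
          (by simp)
        intro ht'
        rcases inf_le_iff.1 ht.1 with h3 | h3 <;> linarith [ht'.2]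
      have := intervalIntegral.integral_add_adjacent_intervals
        (hφ.continuous.intervalIntegrable (μ := volume) 0 x)
        (hφ.continuous.intervalIntegrable (μ := volume) x 1)
      simpa [h0, h2] using this
  have hts := closure_minimal hsupp isClosed_Icc
  refine ⟨fun x => ∫ t in (0 : ℝ)..x, φ t,
    contDiff_infty_iff_deriv.2 ⟨fun x => (hψd x).differentiableAt, by rwa [hder]⟩,
    HasCompactSupport.of_support_subset_isCompact isCompact_Icc hsupp,
    hts.trans fun x hx => ⟨ha.trans_le hx.1, hx.2.trans_lt hb⟩, hder⟩

lemma exists_test_integral_eq_one : ∃ η : ℝ → ℝ, ContDiff ℝ ∞ η ∧ HasCompactSupport η ∧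
    tsupport η ⊆ Ioo 0 1 ∧ ∫ x in (0 : ℝ)..1, η x = 1 := by
  let f : ContDiffBump (1 / 2 : ℝ) := ⟨1 / 8, 1 / 4, by norm_num, by norm_num⟩
  have hs : tsupport (f.normed volume) ⊆ Ioo 0 1 := by
    rw [f.tsupport_normed_eq, Real.closedBall_eq_Icc]
    intro x hx
    simp only [f, mem_Icc] at hx
    constructor <;> linarith [hx.1, hx.2]
  refine ⟨f.normed volume, f.contDiff_normed, f.hasCompactSupport_normed, hs, ?_⟩
  rw [← integral_unitVol]
  refine Eq.trans ?_ (f.integral_normed (μ := volume))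
  exact setIntegral_eq_integral_of_forall_compl_eq_zero
    fun x hx => apply_eq_zero_of_tsupport_subset hs hx

/-- The lemma of du Bois-Reymond: a function with vanishing weak derivative is constant. -/
lemma ae_eq_const_of_isWeakDeriv_zero {f : ℝ → Plane} (hf : Integrable f unitVol)
    (h : IsWeakDeriv f 0) : ∃ c, f =ᵐ[unitVol] fun _ => c := by
  obtain ⟨η, η1, η2, η3, η4⟩ := exists_test_integral_eq_one
  refine ⟨∫ x, η x • f x ∂unitVol, ?_⟩
  have key := ae_eq_zero_of_integral_test (f := fun x => f x - ∫ x, η x • f x ∂unitVol)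
    (hf.sub (integrable_const _)) fun φ φ1 φ2 φ3 => by
    -- `φ - (∫ φ) η` has mean zero, so it is the derivative of a test function.
    set c := ∫ x, η x • f x ∂unitVol with hc
    set m := ∫ x in (0 : ℝ)..1, φ x with hm
    have hsub : tsupport (fun x => φ x - m * η x) ⊆ tsupport φ ∪ tsupport η :=
      (tsupport_sub φ fun x => m * η x).trans
        (union_subset_union_right _ (tsupport_mul_subset_right (f := fun _ => m)))
    obtain ⟨ψ, ψ1, ψ2, ψ3, ψ4⟩ := exists_test_deriv_eq (φ := fun x => φ x - m * η x)
      (φ1.sub (contDiff_const.mul η1)) (φ2.sub η2.mul_left)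
      (hsub.trans (union_subset φ3 η3)) (by
        rw [intervalIntegral.integral_sub (φ1.continuous.intervalIntegrable _ _)
          ((η1.continuous.const_mul m).intervalIntegrable _ _),
          intervalIntegral.integral_const_mul, η4, mul_one, sub_self])
    have h1 := h ψ ψ1 ψ2 ψ3
    simp only [ψ4, sub_smul, mul_smul, Pi.zero_apply, smul_zero, integral_zero, neg_zero] at h1
    have hi : Integrable (fun x => m • η x • f x) unitVol :=
      (integrable_smul η1.continuous hf).smul m
    rw [integral_sub (integrable_smul φ1.continuous hf) hi, integral_smul, ← hc] at h1
    simp only [smul_sub]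
    rw [integral_sub (integrable_smul φ1.continuous hf)
      (integrable_smul φ1.continuous (integrable_const _)), integral_smul_const,
      integral_unitVol φ, ← hm, h1]
  filter_upwards [key] with x hx
  exact sub_eq_zero.1 hx

lemma IsWeakDeriv.ae_eq_primitive {u v : ℝ → Plane} (hu : Integrable u unitVol)
    (hv : Integrable v unitVol) (h : IsWeakDeriv u v) :
    ∃ a, u =ᵐ[unitVol] primitive a v := by
  have hp := integrable_unitVol_of_continuous (continuous_primitive 0 hv)
  obtain ⟨c, hc⟩ := ae_eq_const_of_isWeakDeriv_zero (hu.sub hp) fun φ h1 h2 h3 => by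
    have hd : Continuous (deriv φ) := h1.continuous_deriv (by simp)
    simp only [Pi.sub_apply, smul_sub]
    rw [integral_sub (integrable_smul hd hu) (integrable_smul hd hp), h φ h1 h2 h3,
      isWeakDeriv_primitive 0 hv φ h1 h2 h3]
    simp
  refine ⟨c, ?_⟩
  filter_upwards [hc] with x hx
  rw [Pi.sub_apply, sub_eq_iff_eq_add] at hx
  rw [hx, primitive, primitive, zero_add]

/-! ### Curves of class `H²` and arcs -/

lemma integrable_of_memLp_two {w : ℝ → Plane} (hw : MemLp w 2 unitVol) : Integrable w unitVol :=
  hw.integrable one_le_two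

lemma primitive_congr (a : Plane) {v w : ℝ → Plane} (h : v =ᵐ[unitVol] w) :
    primitive a v = primitive a w := by
  funext x
  rw [primitive, primitive, intervalIntegral.integral_congr_ae_restrict]
  exact ae_restrict_of_ae h

lemma primitive_smul (c : ℝ) (a : Plane) (w : ℝ → Plane) (x : ℝ) :
    primitive (c • a) (c • w) x = c • primitive a w x := by
  simp [primitive, smul_add, intervalIntegral.integral_smul]

lemma hasDerivAt_integral {V : ℝ → Plane} (hV : Continuous V) (x : ℝ) :
    HasDerivAt (fun x => ∫ s in (0 : ℝ)..x, V s) (V x) x :=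
  intervalIntegral.integral_hasDerivAt_right (hV.intervalIntegrable _ _)
    (hV.stronglyMeasurableAtFilter _ _) hV.continuousAt

lemma IsWeakDeriv.congr_left {u u' v : ℝ → Plane} (h : IsWeakDeriv u v)
    (hu : u =ᵐ[unitVol] u') : IsWeakDeriv u' v := by
  intro φ h1 h2 h3
  rw [← h φ h1 h2 h3]
  refine integral_congr_ae ?_
  filter_upwards [hu] with x hx
  rw [hx]

lemma IsSecondWeakDeriv.ae_eq {u w w' : ℝ → Plane} (h : IsSecondWeakDeriv u w)
    (h' : IsSecondWeakDeriv u w') : w =ᵐ[unitVol] w' := by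
  obtain ⟨v, hv, huv, hw, hvw⟩ := h
  obtain ⟨v', hv', huv', hw', hvw'⟩ := h'
  have := huv'.ae_eq (integrable_of_memLp_two hv') (integrable_of_memLp_two hv) huv
  exact hvw.ae_eq (integrable_of_memLp_two hw) (integrable_of_memLp_two hw')
    (hvw'.congr_left this)

lemma IsSecondWeakDeriv.secondDeriv {u w : ℝ → Plane} (h : IsSecondWeakDeriv u w) :
    IsSecondWeakDeriv u (secondDeriv u) := by
  have hex : ∃ w, IsSecondWeakDeriv u w := ⟨w, h⟩
  rw [ThetaNet.secondDeriv, dif_pos hex]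
  exact hex.choose_spec

/-- One-dimensional Sobolev regularity: an `H²` curve is `C¹` on `[0,1]`, and its velocity is a
primitive of its second weak derivative. -/
lemma IsH2Curve.exists_primitive {γ : ℝ → Plane} (h : IsH2Curve γ) :
    MemLp (secondDeriv γ) 2 unitVol ∧ ∃ b,
      (∀ x ∈ Icc (0 : ℝ) 1, velocity γ x = primitive b (secondDeriv γ) x) ∧
      γ 1 - γ 0 = ∫ x in (0 : ℝ)..1, primitive b (secondDeriv γ) x := by
  obtain ⟨hc, hu, w, hw⟩ := h
  obtain ⟨v, hv, huv, hw, hvw⟩ := hw.secondDeriv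
  have hw1 := integrable_of_memLp_two hw
  have hv1 := integrable_of_memLp_two hv
  obtain ⟨b, hb⟩ := hvw.ae_eq_primitive hv1 hw1
  obtain ⟨a, ha⟩ := huv.ae_eq_primitive (integrable_of_memLp_two hu) hv1
  rw [primitive_congr a hb] at ha
  set V := primitive b (ThetaNet.secondDeriv γ)
  have hV : Continuous V := continuous_primitive b hw1
  have heq : EqOn γ (primitive a V) (Icc 0 1) := by
    refine Measure.eqOn_Icc_of_ae_eq volume zero_ne_one ?_ hc
      (continuous_primitive a (integrable_unitVol_of_continuous hV)).continuousOn
    rwa [Measure.restrict_congr_set Ioo_ae_eq_Icc.symm]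
  have heq' : EqOn γ (fun x => a + ∫ s in (0 : ℝ)..x, V s) (Icc 0 1) := fun x hx => by
    rw [heq hx, primitive, intervalIntegral_unitVol V hx]
  refine ⟨hw, b, fun x hx => ?_, ?_⟩
  · exact (((hasDerivAt_integral hV x).const_add a).hasDerivWithinAt.congr heq'
      (heq' hx)).derivWithin (uniqueDiffOn_Icc zero_lt_one x hx)
  · rw [heq' (right_mem_Icc.2 zero_le_one), heq' (left_mem_Icc.2 zero_le_one)]
    simp [V]

/-- The data of a curve of constant speed, up to translation: its length, its initial direction,
and the derivative of its unit tangent as an element of `L²(0,1)`. -/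
structure Arc where
  /-- the length -/
  len : ℝ
  /-- the unit tangent at `0` -/
  start : Plane
  /-- the derivative of the unit tangent -/
  curv : Lp Plane 2 unitVol

namespace Arc

/-- The unit tangent of an arc, as a function on `[0,1]`. -/
noncomputable def dir (D : Arc) : ℝ → Plane := primitive D.start D.curv

/-- The average of the unit tangent: the end point minus the initial point, divided by the
length. -/
noncomputable def mean (D : Arc) : Plane := ∫ x in (0 : ℝ)..1, D.dir x

/-- The elastic energy plus length of an arc. -/
noncomputable def energy (D : Arc) : ℝ := ‖D.curv‖ ^ 2 / D.len + D.len

/-- An arc is unit if its length is positive and `dir` is indeed of norm one on `[0,1]`. -/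
def IsUnit (D : Arc) : Prop := 0 < D.len ∧ ∀ x ∈ Icc (0 : ℝ) 1, ‖D.dir x‖ = 1

/-- The curve with initial point `0` described by an arc. -/
noncomputable def curve (D : Arc) (x : ℝ) : Plane := D.len • ∫ s in (0 : ℝ)..x, D.dir s

lemma integrable_curv (D : Arc) : Integrable D.curv unitVol :=
  integrable_of_memLp_two (Lp.memLp D.curv)

lemma continuous_dir (D : Arc) : Continuous D.dir := continuous_primitive _ D.integrable_curv

lemma hasDerivAt_curve (D : Arc) (x : ℝ) : HasDerivAt D.curve (D.len • D.dir x) x :=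
  (hasDerivAt_integral D.continuous_dir x).const_smul D.len

lemma continuous_curve (D : Arc) : Continuous D.curve :=
  continuous_iff_continuousAt.2 fun x => (D.hasDerivAt_curve x).continuousAt

lemma curve_zero (D : Arc) : D.curve 0 = 0 := by simp [curve]

lemma curve_one (D : Arc) : D.curve 1 = D.len • D.mean := rfl

lemma isSecondWeakDeriv_curve (D : Arc) : IsSecondWeakDeriv D.curve (D.len • ⇑D.curv) := by
  have hd : Continuous (D.len • D.dir) := D.continuous_dir.const_smul D.len
  refine ⟨D.len • D.dir, memLp_two_of_continuous hd, ?_, (Lp.memLp D.curv).const_smul _, ?_⟩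
  · refine (isWeakDeriv_primitive 0 (integrable_unitVol_of_continuous hd)).congr_left ?_
    filter_upwards [ae_restrict_mem measurableSet_Ioo] with x hx
    rw [primitive, intervalIntegral_unitVol _ (Ioo_subset_Icc_self hx), zero_add, curve]
    simp
  · have := isWeakDeriv_primitive (D.len • D.start) (D.integrable_curv.smul D.len)
    rwa [show primitive (D.len • D.start) (D.len • ⇑D.curv) = D.len • D.dir from
      funext fun x => primitive_smul _ _ _ _] at this

lemma isH2Curve_curve (D : Arc) : IsH2Curve D.curve :=
  ⟨D.continuous_curve.continuousOn, memLp_two_of_continuous D.continuous_curve,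
    _, D.isSecondWeakDeriv_curve⟩

lemma velocity_curve (D : Arc) {x : ℝ} (hx : x ∈ Icc (0 : ℝ) 1) :
    velocity D.curve x = D.len • D.dir x :=
  (D.hasDerivAt_curve x).hasDerivWithinAt.derivWithin (uniqueDiffOn_Icc zero_lt_one x hx)

lemma IsUnit.norm_velocity {D : Arc} (hD : D.IsUnit) {x : ℝ} (hx : x ∈ Icc (0 : ℝ) 1) :
    ‖velocity D.curve x‖ = D.len := by
  rw [D.velocity_curve hx, norm_smul, hD.2 x hx, mul_one, Real.norm_of_nonneg hD.1.le]

lemma IsUnit.isRegular {D : Arc} (hD : D.IsUnit) : IsRegular D.curve := fun x hx => by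
  rw [← norm_pos_iff, hD.norm_velocity hx]
  exact hD.1

lemma IsUnit.length_curve {D : Arc} (hD : D.IsUnit) : length D.curve = D.len := by
  rw [length, intervalIntegral.integral_congr (g := fun _ => D.len)]
  · simp
  · intro x hx
    rw [uIcc_of_le zero_le_one] at hx
    exact hD.norm_velocity hx

lemma IsUnit.tangent_curve {D : Arc} (hD : D.IsUnit) {x : ℝ} (hx : x ∈ Icc (0 : ℝ) 1) :
    tangent D.curve x = D.dir x := by
  rw [tangent, hD.norm_velocity hx, D.velocity_curve hx, inv_smul_smul₀ hD.1.ne']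

lemma IsUnit.energy_nonneg {D : Arc} (hD : D.IsUnit) : 0 ≤ D.energy := by
  have := hD.1
  unfold energy
  positivity

end Arc

lemma norm_sq_eq_integral (f : Lp Plane 2 unitVol) :
    ‖f‖ ^ 2 = ∫ x in (0 : ℝ)..1, ‖f x‖ ^ 2 := by
  rw [← real_inner_self_eq_norm_sq, L2.inner_def, integral_unitVol]
  simp_rw [real_inner_self_eq_norm_sq]

lemma integral_norm_sq_congr {v w : ℝ → Plane} (h : v =ᵐ[unitVol] w) :
    ∫ x in (0 : ℝ)..1, ‖v x‖ ^ 2 = ∫ x in (0 : ℝ)..1, ‖w x‖ ^ 2 := by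
  rw [← integral_unitVol, ← integral_unitVol]
  refine integral_congr_ae ?_
  filter_upwards [h] with x hx
  rw [hx]

lemma Arc.IsUnit.curveEnergy_curve {D : Arc} (hD : D.IsUnit) :
    curveEnergy D.curve = D.energy := by
  have h : secondDeriv D.curve =ᵐ[unitVol] D.len • ⇑D.curv :=
    D.isSecondWeakDeriv_curve.secondDeriv.ae_eq D.isSecondWeakDeriv_curve
  have h0 := hD.1.ne'
  rw [curveEnergy, hD.length_curve, integral_norm_sq_congr h, Arc.energy, norm_sq_eq_integral]
  simp only [Pi.smul_apply, norm_smul, mul_pow, intervalIntegral.integral_const_mul,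
    Real.norm_eq_abs, sq_abs]
  field_simp

/-- A regular `H²` curve of constant speed is described by an arc. -/
lemma IsH2Curve.exists_arc {γ : ℝ → Plane} (h : IsH2Curve γ) (hr : IsRegular γ)
    (hs : ∀ x ∈ Icc (0 : ℝ) 1, ‖velocity γ x‖ = length γ) :
    ∃ D : Arc, D.IsUnit ∧ D.energy = curveEnergy γ ∧
      (∀ x ∈ Icc (0 : ℝ) 1, D.dir x = tangent γ x) ∧ D.len • D.mean = γ 1 - γ 0 := by
  obtain ⟨hw, b, hb, h1⟩ := h.exists_primitive
  have hL : 0 < length γ := by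
    rw [← hs 0 (by simp), norm_pos_iff]
    exact hr 0 (by simp)
  set w := secondDeriv γ
  have hw' : MemLp ((length γ)⁻¹ • w) 2 unitVol := hw.const_smul _
  let D : Arc := ⟨length γ, (length γ)⁻¹ • b, hw'.toLp⟩
  have hdir : ∀ x, D.dir x = (length γ)⁻¹ • primitive b w x := fun x => by
    rw [Arc.dir, primitive_congr _ hw'.coeFn_toLp, primitive_smul]
  have hdir' : ∀ x ∈ Icc (0 : ℝ) 1, D.dir x = tangent γ x := fun x hx => by
    rw [hdir, tangent, hs x hx, hb x hx]
  refine ⟨D, ⟨hL, fun x hx => ?_⟩, ?_, hdir', ?_⟩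
  · rw [hdir' x hx, tangent, norm_smul, norm_inv, norm_norm, inv_mul_cancel₀]
    rw [hs x hx]
    exact hL.ne'
  · rw [Arc.energy, curveEnergy, norm_sq_eq_integral, integral_norm_sq_congr hw'.coeFn_toLp]
    simp only [Pi.smul_apply, norm_smul, mul_pow, intervalIntegral.integral_const_mul,
      Real.norm_eq_abs, sq_abs, D]
    field_simp
    rfl
  · simp_rw [Arc.mean, hdir]
    rw [intervalIntegral.integral_smul, h1, smul_inv_smul₀ hL.ne']

/-! ### Compactness of arcs of bounded energy -/

open Filter Topology

lemma exists_tendsto_of_isCompact {ι X : Type*} [TopologicalSpace X] (𝓤 : Ultrafilter ι)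
    {f : ι → X} {K : Set X} (hK : IsCompact K) (h : ∀ᶠ n in 𝓤, f n ∈ K) :
    ∃ x ∈ K, Tendsto f 𝓤 (𝓝 x) := by
  obtain ⟨x, hx, hle⟩ := hK.ultrafilter_le_nhds (𝓤.map f) (le_principal_iff.2 h)
  exact ⟨x, hx, hle⟩

section Hilbert

variable {ι H F : Type*} [NormedAddCommGroup H] [InnerProductSpace ℝ H]
  [NormedAddCommGroup F] [InnerProductSpace ℝ F] [FiniteDimensional ℝ F]

/-- Weak compactness of bounded sets of a Hilbert space, along an ultrafilter. -/
lemma exists_weak_limit [CompleteSpace H] (𝓤 : Ultrafilter ι) {w : ι → H} {C : ℝ}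
    (h : ∀ᶠ n in 𝓤, ‖w n‖ ≤ C) :
    ∃ v, ∀ u, Tendsto (fun n => inner ℝ (w n) u) 𝓤 (𝓝 (inner ℝ v u)) := by
  obtain ⟨f, -, hf⟩ := exists_tendsto_of_isCompact 𝓤
    (f := fun n => StrongDual.toWeakDual (InnerProductSpace.toDual ℝ H (w n)))
    (WeakDual.isCompact_closedBall (𝕜 := ℝ) (E := H) 0 C) (by
      filter_upwards [h] with n hn
      simpa using hn)
  refine ⟨(InnerProductSpace.toDual ℝ H).symm (WeakDual.toStrongDual f), fun u => ?_⟩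
  have := ((WeakDual.eval_continuous u).tendsto f).comp hf
  simpa [Function.comp_def] using this

lemma tendsto_clm_of_weak [CompleteSpace H] {l : Filter ι} {w : ι → H} {v : H}
    (h : ∀ u, Tendsto (fun n => inner ℝ (w n) u) l (𝓝 (inner ℝ v u))) (T : H →L[ℝ] F) :
    Tendsto (fun n => T (w n)) l (𝓝 (T v)) := by
  have key : ∀ x, T x = ∑ i, inner ℝ x (T.adjoint (stdOrthonormalBasis ℝ F i)) •
      stdOrthonormalBasis ℝ F i := fun x => by
    refine ((stdOrthonormalBasis ℝ F).sum_repr' (T x)).symm.trans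
      (Finset.sum_congr rfl fun i _ => ?_)
    rw [ContinuousLinearMap.adjoint_inner_right, real_inner_comm]
  rw [key v]
  simp_rw [key (w _)]
  exact tendsto_finsetSum _ fun i _ => (h _).smul_const _

/-- The norm is weakly lower semicontinuous. -/
lemma norm_sq_le_of_weak {l : Filter ι} [l.NeBot] {w : ι → H} {v : H} {E : ℝ}
    (h : ∀ u, Tendsto (fun n => inner ℝ (w n) u) l (𝓝 (inner ℝ v u)))
    (hE : Tendsto (fun n => ‖w n‖ ^ 2) l (𝓝 E)) : ‖v‖ ^ 2 ≤ E := by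
  have h1 : Tendsto (fun n => ‖w n - v‖ ^ 2) l (𝓝 (E - 2 * ‖v‖ ^ 2 + ‖v‖ ^ 2)) := by
    simp_rw [norm_sub_sq_real]
    have := h v
    rw [real_inner_self_eq_norm_sq] at this
    exact (hE.sub (this.const_mul 2)).add_const _
  have := ge_of_tendsto' h1 fun n => sq_nonneg _
  linarith

end Hilbert

instance : IsProbabilityMeasure unitVol := ⟨by simp⟩

lemma integral_norm_le_norm (w : Lp Plane 2 unitVol) : ∫ s, ‖w s‖ ∂unitVol ≤ ‖w‖ := by
  rw [integral_norm_eq_lintegral_enorm (Lp.aestronglyMeasurable w),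
    ← eLpNorm_one_eq_lintegral_enorm, Lp.norm_def]
  exact ENNReal.toReal_mono (Lp.memLp w).eLpNorm_ne_top
    (eLpNorm_le_eLpNorm_of_exponent_le one_le_two (Lp.aestronglyMeasurable w))

lemma norm_primitive_zero_le (w : Lp Plane 2 unitVol) (x : ℝ) : ‖primitive 0 w x‖ ≤ ‖w‖ := by
  have hw := integrable_of_memLp_two (Lp.memLp w)
  rw [primitive, zero_add]
  exact (intervalIntegral.norm_integral_le_integral_norm_uIoc).trans
    ((setIntegral_le_integral hw.norm (ae_of_all _ fun _ => norm_nonneg _)).trans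
      (integral_norm_le_norm w))

lemma primitive_zero_add (v w : Lp Plane 2 unitVol) (x : ℝ) :
    primitive 0 (v + w : Lp Plane 2 unitVol) x = primitive 0 v x + primitive 0 w x := by
  have hv := integrable_of_memLp_two (Lp.memLp v)
  have hw := integrable_of_memLp_two (Lp.memLp w)
  rw [primitive_congr 0 (Lp.coeFn_add v w)]
  simp [primitive, intervalIntegral.integral_add hv.intervalIntegrable hw.intervalIntegrable]

lemma primitive_zero_smul (c : ℝ) (w : Lp Plane 2 unitVol) (x : ℝ) :
    primitive 0 (c • w : Lp Plane 2 unitVol) x = c • primitive 0 w x := by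
  rw [primitive_congr 0 (Lp.coeFn_smul c w), ← primitive_smul, smul_zero]

/-- The value at `x` of the primitive vanishing at `0`, as a bounded operator on `L²(0,1)`. -/
noncomputable def primitiveCLM (x : ℝ) : Lp Plane 2 unitVol →L[ℝ] Plane :=
  LinearMap.mkContinuous
    { toFun := fun w => primitive 0 w x
      map_add' := fun v w => primitive_zero_add v w x
      map_smul' := fun c w => primitive_zero_smul c w x } 1 fun w => by
    simpa using norm_primitive_zero_le w x

lemma continuous_primitive_zero (w : Lp Plane 2 unitVol) : Continuous (primitive 0 w) :=
  continuous_primitive 0 (integrable_of_memLp_two (Lp.memLp w))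

/-- The mean over `(0,1)` of the primitive vanishing at `0`, as a bounded operator on
`L²(0,1)`. -/
noncomputable def meanCLM : Lp Plane 2 unitVol →L[ℝ] Plane :=
  LinearMap.mkContinuous
    { toFun := fun w => ∫ x in (0 : ℝ)..1, primitive 0 w x
      map_add' := fun v w => by
        simp_rw [primitive_zero_add]
        exact intervalIntegral.integral_add ((continuous_primitive_zero v).intervalIntegrable _ _)
          ((continuous_primitive_zero w).intervalIntegrable _ _)
      map_smul' := fun c w => by
        simp_rw [primitive_zero_smul]
        exact intervalIntegral.integral_smul _ _ } 1 fun w => by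
    simpa using intervalIntegral.norm_integral_le_of_norm_le_const (a := 0) (b := 1)
      fun x _ => norm_primitive_zero_le w x

namespace Arc

lemma dir_eq (D : Arc) (x : ℝ) : D.dir x = D.start + primitiveCLM x D.curv := by
  simp [dir, primitiveCLM, primitive]

lemma mean_eq (D : Arc) : D.mean = D.start + meanCLM D.curv := by
  have : D.mean = ∫ x in (0 : ℝ)..1, (D.start + primitive 0 D.curv x) := by
    simp [mean, dir, primitive]
  rw [this, intervalIntegral.integral_add (by simp)
    ((continuous_primitive_zero D.curv).intervalIntegrable _ _)]
  simp [meanCLM]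

/-- `A` is a limit of the unit arcs `D n` in the topology for which bounded energy gives
compactness: lengths, unit tangents and their means converge, the energies converge to `e`, and
the curvature term is lower semicontinuous. The length of `A` may vanish; since
`‖curv‖² = (energy - len) * len` for an arc of positive length, `A` has no curvature then. -/
structure IsLimit {ι : Type*} (l : Filter ι) (D : ι → Arc) (A : Arc) (e : ℝ) : Prop where
  len_nonneg : 0 ≤ A.len
  tendsto_len : Tendsto (fun n => (D n).len) l (𝓝 A.len)
  tendsto_dir : ∀ x, Tendsto (fun n => (D n).dir x) l (𝓝 (A.dir x))
  tendsto_mean : Tendsto (fun n => (D n).mean) l (𝓝 A.mean)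
  norm_dir : ∀ x ∈ Icc (0 : ℝ) 1, ‖A.dir x‖ = 1
  energy_nonneg : 0 ≤ e
  tendsto_energy : Tendsto (fun n => (D n).energy) l (𝓝 e)
  norm_curv_sq_le : ‖A.curv‖ ^ 2 ≤ (e - A.len) * A.len

lemma IsUnit.norm_curv_sq {D : Arc} (hD : D.IsUnit) :
    ‖D.curv‖ ^ 2 = (D.energy - D.len) * D.len := by
  rw [energy, add_sub_cancel_right, div_mul_cancel₀ _ hD.1.ne']

lemma IsUnit.len_le_energy {D : Arc} (hD : D.IsUnit) : D.len ≤ D.energy :=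
  le_add_of_nonneg_left (div_nonneg (sq_nonneg _) hD.1.le)

/-- Compactness of unit arcs of bounded energy. -/
lemma exists_isLimit {ι : Type*} (𝓤 : Ultrafilter ι) {D : ι → Arc} {C : ℝ}
    (hD : ∀ᶠ n in 𝓤, (D n).IsUnit) (hC : ∀ᶠ n in 𝓤, (D n).energy ≤ C) :
    ∃ A e, IsLimit 𝓤 D A e := by
  obtain ⟨e, he, hte⟩ := exists_tendsto_of_isCompact 𝓤 (f := fun n => (D n).energy)
    (isCompact_Icc (a := 0) (b := C)) (by
      filter_upwards [hD, hC] with n h1 h2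
      exact ⟨h1.energy_nonneg, h2⟩)
  obtain ⟨L, hL, htL⟩ := exists_tendsto_of_isCompact 𝓤 (f := fun n => (D n).len)
    (isCompact_Icc (a := 0) (b := C)) (by
      filter_upwards [hD, hC] with n h1 h2
      exact ⟨h1.1.le, h1.len_le_energy.trans h2⟩)
  obtain ⟨a, -, hta⟩ := exists_tendsto_of_isCompact 𝓤 (f := fun n => (D n).start)
    (isCompact_closedBall (0 : Plane) 1) (by
      filter_upwards [hD] with n h1
      have := h1.2 0 (by simp)
      rw [dir, primitive_zero] at this
      simp [this])
  obtain ⟨w, hw⟩ := exists_weak_limit 𝓤 (w := fun n => (D n).curv) (C := C) (by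
    filter_upwards [hD, hC] with n h1 h2
    have h3 := h1.1
    have h4 := h1.len_le_energy
    refine abs_le_of_sq_le_sq' ?_ (by linarith) |>.2
    rw [h1.norm_curv_sq, sq]
    exact mul_le_mul (by linarith) (by linarith) h3.le (by linarith))
  have hdir : ∀ x, Tendsto (fun n => (D n).dir x) 𝓤 (𝓝 ((⟨L, a, w⟩ : Arc).dir x)) := fun x => by
    simp_rw [dir_eq]
    exact hta.add (tendsto_clm_of_weak hw _)
  refine ⟨⟨L, a, w⟩, e, hL.1, htL, hdir, ?_, fun x hx => ?_, he.1, hte, ?_⟩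
  · simp_rw [mean_eq]
    exact hta.add (tendsto_clm_of_weak hw _)
  · refine tendsto_nhds_unique (hdir x).norm (tendsto_const_nhds.congr' ?_)
    filter_upwards [hD] with n h1
    exact (h1.2 x hx).symm
  · refine norm_sq_le_of_weak hw (((hte.sub htL).mul htL).congr' ?_)
    filter_upwards [hD] with n h1
    exact h1.norm_curv_sq.symm

namespace IsLimit

variable {ι : Type*} {l : Filter ι} {D : ι → Arc} {A : Arc} {e : ℝ}

lemma isUnit (h : IsLimit l D A e) (hA : 0 < A.len) : A.IsUnit := ⟨hA, h.norm_dir⟩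

lemma energy_le (h : IsLimit l D A e) (hA : 0 < A.len) : A.energy ≤ e := by
  have := (div_le_iff₀ hA).2 h.norm_curv_sq_le
  rw [energy]
  linarith

lemma curv_eq_zero (h : IsLimit l D A e) (hA : A.len = 0) : A.curv = 0 := by
  have := h.norm_curv_sq_le
  rw [hA, mul_zero] at this
  exact norm_eq_zero.1 (pow_eq_zero_iff two_ne_zero |>.1 (le_antisymm this (sq_nonneg _)))

lemma dir_eq_start (h : IsLimit l D A e) (hA : A.len = 0) (x : ℝ) : A.dir x = A.start := by
  rw [dir_eq, h.curv_eq_zero hA, map_zero, add_zero]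

lemma mean_eq_start (h : IsLimit l D A e) (hA : A.len = 0) : A.mean = A.start := by
  rw [mean_eq, h.curv_eq_zero hA, map_zero, add_zero]

lemma norm_start (h : IsLimit l D A e) : ‖A.start‖ = 1 := by
  have := h.norm_dir 0 (by simp)
  rwa [dir, primitive_zero] at this

/-- A closed curve of bounded energy cannot be short: if the length tends to `0`, the unit tangent
becomes constant and cannot have vanishing mean. -/
lemma len_pos_of_mean_eq_zero (h : IsLimit l D A e) (hm : A.mean = 0) : 0 < A.len := by
  refine h.len_nonneg.lt_of_ne' fun h0 => ?_
  have := h.norm_start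
  rw [← h.mean_eq_start h0, hm, norm_zero] at this
  exact zero_ne_one this

end IsLimit

end Arc

/-! ### Angles of `120` degrees in the plane -/

lemma cos_two_pi_div_three : Real.cos (2 * Real.pi / 3) = -1 / 2 := by
  rw [show 2 * Real.pi / 3 = Real.pi - Real.pi / 3 by ring, Real.cos_pi_sub,
    Real.cos_pi_div_three]
  norm_num

lemma angle_eq_iff_inner {a b : Plane} (ha : ‖a‖ = 1) (hb : ‖b‖ = 1) :
    InnerProductGeometry.angle a b = 2 * Real.pi / 3 ↔ inner ℝ a b = -1 / 2 := by
  have hab : Real.cos (InnerProductGeometry.angle a b) = inner ℝ a b := by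
    rw [InnerProductGeometry.cos_angle, ha, hb]
    simp
  rw [← hab, ← cos_two_pi_div_three]
  refine ⟨fun h => by rw [h], fun h => Real.injOn_cos
    ⟨InnerProductGeometry.angle_nonneg _ _, InnerProductGeometry.angle_le_pi _ _⟩ ?_ h⟩
  constructor <;> linarith [Real.pi_pos]

lemma formAngles_iff {a a' b b' : Plane} (ha : ‖a‖ = 1) (hb : ‖b‖ = 1) :
    FormAngles a a' b b' ↔
      inner ℝ a b = -1 / 2 ∧ ((a = -a' ∧ b = -b') ∨ (a = -b' ∧ b = -a')) := by
  rw [FormAngles, angle_eq_iff_inner ha hb, pair_eq_pair_iff]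

/-- The angle condition at the junction of a degenerate network is closed. -/
lemma FormAngles.of_tendsto {ι : Type*} {𝓤 : Ultrafilter ι} {a a' b b' : ι → Plane}
    {A A' B B' : Plane} (ha : Tendsto a 𝓤 (𝓝 A)) (ha' : Tendsto a' 𝓤 (𝓝 A'))
    (hb : Tendsto b 𝓤 (𝓝 B)) (hb' : Tendsto b' 𝓤 (𝓝 B'))
    (h : ∀ᶠ n in 𝓤, ‖a n‖ = 1 ∧ ‖b n‖ = 1 ∧ FormAngles (a n) (a' n) (b n) (b' n)) :
    FormAngles A A' B B' := by
  have hA : ‖A‖ = 1 := tendsto_nhds_unique_of_eventuallyEq ha.norm tendsto_const_nhds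
    (h.mono fun n hn => hn.1)
  have hB : ‖B‖ = 1 := tendsto_nhds_unique_of_eventuallyEq hb.norm tendsto_const_nhds
    (h.mono fun n hn => hn.2.1)
  have h' : ∀ᶠ n in 𝓤, inner ℝ (a n) (b n) = -1 / 2 ∧
      ((a n = -a' n ∧ b n = -b' n) ∨ (a n = -b' n ∧ b n = -a' n)) :=
    h.mono fun n hn => (formAngles_iff hn.1 hn.2.1).1 hn.2.2
  refine (formAngles_iff hA hB).2 ⟨tendsto_nhds_unique_of_eventuallyEq (ha.inner hb)
    tendsto_const_nhds (h'.mono fun n hn => hn.1), ?_⟩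
  rcases Ultrafilter.eventually_or.1 (h'.mono fun n hn => hn.2) with h2 | h2
  · exact .inl ⟨tendsto_nhds_unique_of_eventuallyEq ha ha'.neg (h2.mono fun n hn => hn.1),
      tendsto_nhds_unique_of_eventuallyEq hb hb'.neg (h2.mono fun n hn => hn.2)⟩
  · exact .inr ⟨tendsto_nhds_unique_of_eventuallyEq ha hb'.neg (h2.mono fun n hn => hn.1),
      tendsto_nhds_unique_of_eventuallyEq hb ha'.neg (h2.mono fun n hn => hn.2)⟩

lemma add_eq_neg_of_inner {a b e : Plane} (ha : ‖a‖ = 1) (hb : ‖b‖ = 1) (he : ‖e‖ = 1)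
    (hab : inner ℝ a b = -1 / 2) (hae : inner ℝ a e = -1 / 2) (hbe : inner ℝ b e = -1 / 2) :
    a + b = -e := by
  rw [← add_eq_zero_iff_eq_neg, ← norm_eq_zero, ← sq_eq_zero_iff, norm_add_sq_real,
    norm_add_sq_real, inner_add_left, ha, hb, he, hab, hae, hbe]
  norm_num

/-- In the plane, the two unit vectors forming angles of `120` degrees with a given unit vector
and with each other are determined up to order. -/
lemma eq_or_eq_of_inner {a b c d e : Plane} (ha : ‖a‖ = 1) (hb : ‖b‖ = 1) (hc : ‖c‖ = 1)
    (hd : ‖d‖ = 1) (he : ‖e‖ = 1)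
    (hab : inner ℝ a b = -1 / 2) (hae : inner ℝ a e = -1 / 2) (hbe : inner ℝ b e = -1 / 2)
    (hcd : inner ℝ c d = -1 / 2) (hce : inner ℝ c e = -1 / 2) (hde : inner ℝ d e = -1 / 2) :
    (a = c ∧ b = d) ∨ (a = d ∧ b = c) := by
  have h1 := add_eq_neg_of_inner ha hb he hab hae hbe
  have h2 := add_eq_neg_of_inner hc hd he hcd hce hde
  have hsum : a + b = c + d := h1.trans h2.symm
  -- `a - c` and `a - d` are orthogonal to `e`, hence parallel, and they are orthogonal.
  have hp : inner ℝ (a - c) e = 0 := by rw [inner_sub_left, hae, hce, sub_self]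
  have hq : inner ℝ (a - d) e = 0 := by rw [inner_sub_left, hae, hde, sub_self]
  have hpq : inner ℝ (a - c) (a - d) = 0 := by
    have : inner ℝ a (c + d) = 1 / 2 := by rw [h2, inner_neg_right, hae]; norm_num
    rw [inner_add_right] at this
    rw [inner_sub_left, inner_sub_right, inner_sub_right, real_inner_self_eq_norm_sq, ha, hcd,
      real_inner_comm a c]
    linarith
  -- The coordinates `s`, `t` of `p`, `q` along the rotation of `e` satisfy `s * t = ⟨p, q⟩ = 0`.
  have hz : ∀ p q : Plane, inner ℝ p e = 0 → inner ℝ q e = 0 → inner ℝ p q = 0 →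
      p = 0 ∨ q = 0 := by
    intro p q h1 h2 h3
    have he2 : e 0 ^ 2 + e 1 ^ 2 = 1 := by
      have := EuclideanSpace.real_norm_sq_eq e
      rw [he, Fin.sum_univ_two] at this
      linarith
    simp only [PiLp.inner_apply, Fin.sum_univ_two, RCLike.inner_apply, conj_trivial] at h1 h2 h3
    have hform : ∀ p : Plane, e 0 * p 0 + e 1 * p 1 = 0 →
        p 0 = -(e 0 * p 1 - e 1 * p 0) * e 1 ∧ p 1 = (e 0 * p 1 - e 1 * p 0) * e 0 := by
      intro p h
      constructor
      · linear_combination (-p 0) * he2 + e 0 * h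
      · linear_combination (-p 1) * he2 + e 1 * h
    obtain ⟨hp0, hp1⟩ := hform p h1
    obtain ⟨hq0, hq1⟩ := hform q h2
    set s := e 0 * p 1 - e 1 * p 0
    set t := e 0 * q 1 - e 1 * q 0
    have hst : s * t = 0 := by
      rw [hp0, hp1, hq0, hq1] at h3
      linear_combination h3 - s * t * he2
    rcases mul_eq_zero.1 hst with h | h
    · left
      ext i
      fin_cases i
      · simpa [h] using hp0
      · simpa [h] using hp1
    · right
      ext i
      fin_cases i
      · simpa [h] using hq0
      · simpa [h] using hq1
  rcases hz _ _ hp hq hpq with h | h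
  · have := sub_eq_zero.1 h
    exact .inl ⟨this, by rw [this] at hsum; exact add_left_cancel hsum⟩
  · have := sub_eq_zero.1 h
    exact .inr ⟨this, by rw [this, add_comm c d] at hsum; exact add_left_cancel hsum⟩

/-! ### Limits of Theta-networks -/

/-- The arc of length zero, whose curve is a point. -/
noncomputable instance : Inhabited Arc := ⟨⟨0, 0, 0⟩⟩

/-- The three arcs of a Theta-network with first junction at the origin. The angles of `120`
degrees are expressed by inner products of unit tangents. -/
structure IsThetaTriple (D : Fin 3 → Arc) : Prop where
  isUnit : ∀ i, (D i).IsUnit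
  chord_eq : ∀ i j, (D i).len • (D i).mean = (D j).len • (D j).mean
  inner_zero : ∀ i j, i ≠ j → inner ℝ ((D i).dir 0) ((D j).dir 0) = -1 / 2
  inner_one : ∀ i j, i ≠ j → inner ℝ ((D i).dir 1) ((D j).dir 1) = -1 / 2

/-- The two regular arcs of a degenerate Theta-network based at the origin. -/
structure IsDegeneratePair (A B : Arc) : Prop where
  isUnit_left : A.IsUnit
  isUnit_right : B.IsUnit
  mean_left : A.mean = 0
  mean_right : B.mean = 0
  formAngles : FormAngles (A.dir 0) (-A.dir 1) (B.dir 0) (-B.dir 1) ∨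
    FormAngles (A.dir 0) (-A.dir 1) (-B.dir 1) (B.dir 0)

/-- The values of the functional on Theta-networks and degenerate Theta-networks. -/
def energyValues : Set ℝ :=
  {r | (∃ D, IsThetaTriple D ∧ ∑ i, (D i).energy = r) ∨
    ∃ A B, IsDegeneratePair A B ∧ A.energy + B.energy = r}

/-- Theta-networks of convergent energy converge to a Theta-network, or to a degenerate one if
one of the lengths tends to `0`; the energy of the limit is at most the limit of the energies. -/
lemma exists_le_of_theta {𝓤 : Ultrafilter ℕ} {D : ℕ → Fin 3 → Arc} {m : ℝ}
    (hD : ∀ᶠ n in 𝓤, IsThetaTriple (D n))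
    (hm : Tendsto (fun n => ∑ i, (D n i).energy) 𝓤 (𝓝 m)) : ∃ r ∈ energyValues, r ≤ m := by
  have hC : ∀ i, ∀ᶠ n in 𝓤, (D n i).energy ≤ m + 1 := fun i => by
    filter_upwards [hD, hm.eventually_le_const (lt_add_one m)] with n h1 h2
    exact (Finset.single_le_sum (fun j _ => (h1.isUnit j).energy_nonneg)
      (Finset.mem_univ i)).trans h2
  choose A e hA using fun i => Arc.exists_isLimit 𝓤 (hD.mono fun n h => h.isUnit i) (hC i)
  have hsum : ∑ i, e i = m :=
    tendsto_nhds_unique (tendsto_finsetSum _ fun i _ => (hA i).tendsto_energy) hm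
  have chord : ∀ i j, (A i).len • (A i).mean = (A j).len • (A j).mean := fun i j =>
    tendsto_nhds_unique_of_eventuallyEq ((hA i).tendsto_len.smul (hA i).tendsto_mean)
      ((hA j).tendsto_len.smul (hA j).tendsto_mean) (hD.mono fun n h => h.chord_eq i j)
  have inner0 : ∀ i j, i ≠ j → inner ℝ ((A i).dir 0) ((A j).dir 0) = -1 / 2 := fun i j hij =>
    tendsto_nhds_unique_of_eventuallyEq (((hA i).tendsto_dir 0).inner ((hA j).tendsto_dir 0))
      tendsto_const_nhds (hD.mono fun n h => h.inner_zero i j hij)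
  have inner1 : ∀ i j, i ≠ j → inner ℝ ((A i).dir 1) ((A j).dir 1) = -1 / 2 := fun i j hij =>
    tendsto_nhds_unique_of_eventuallyEq (((hA i).tendsto_dir 1).inner ((hA j).tendsto_dir 1))
      tendsto_const_nhds (hD.mono fun n h => h.inner_one i j hij)
  have n0 : ∀ i, ‖(A i).dir 0‖ = 1 := fun i => (hA i).norm_dir 0 (by simp)
  have n1 : ∀ i, ‖(A i).dir 1‖ = 1 := fun i => (hA i).norm_dir 1 (by simp)
  -- Two short arcs would be almost straight segments with the same end points that leave the
  -- first junction at an angle of `120` degrees.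
  have notboth : ∀ i j, i ≠ j → (A i).len = 0 → (A j).len = 0 → False := by
    intro i j hij hi hj
    have hneg : ∀ᶠ n in 𝓤, inner ℝ (D n i).mean (D n j).mean < 0 := by
      refine ((hA i).tendsto_mean.inner (hA j).tendsto_mean).eventually_lt_const ?_
      rw [(hA i).mean_eq_start hi, (hA j).mean_eq_start hj, ← (hA i).dir_eq_start hi 0,
        ← (hA j).dir_eq_start hj 0, inner0 i j hij]
      norm_num
    obtain ⟨n, h1, h2⟩ := (hneg.and hD).exists
    have h3 := congrArg (inner ℝ (D n i).mean) (h2.chord_eq i j)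
    rw [inner_smul_right, inner_smul_right] at h3
    have h4 := mul_nonneg (h2.isUnit i).1.le (real_inner_self_nonneg (x := (D n i).mean))
    have h5 := mul_neg_of_pos_of_neg (h2.isUnit j).1 h1
    linarith
  by_cases hpos : ∀ i, 0 < (A i).len
  · refine ⟨∑ i, (A i).energy, .inl ⟨A, ⟨fun i => (hA i).isUnit (hpos i), chord, inner0, inner1⟩,
      rfl⟩, ?_⟩
    rw [← hsum]
    exact Finset.sum_le_sum fun i _ => (hA i).energy_le (hpos i)
  · obtain ⟨k, hk⟩ := not_forall.1 hpos
    have hk0 : (A k).len = 0 := le_antisymm (not_lt.1 hk) (hA k).len_nonneg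
    obtain ⟨i, j, hij, hik, hjk, huniv⟩ : ∃ i j : Fin 3, i ≠ j ∧ i ≠ k ∧ j ≠ k ∧
        (Finset.univ : Finset (Fin 3)) = {i, j, k} := by
      clear hk hk0
      revert k
      decide
    have hi : 0 < (A i).len := (hA i).len_nonneg.lt_of_ne' fun h => notboth i k hik h hk0
    have hj : 0 < (A j).len := (hA j).len_nonneg.lt_of_ne' fun h => notboth j k hjk h hk0
    have hmi : (A i).mean = 0 := by
      have := chord i k
      rw [hk0, zero_smul, smul_eq_zero] at this
      exact this.resolve_left hi.ne'
    have hmj : (A j).mean = 0 := by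
      have := chord j k
      rw [hk0, zero_smul, smul_eq_zero] at this
      exact this.resolve_left hj.ne'
    have hkd : (A k).dir 1 = (A k).dir 0 := by
      rw [(hA k).dir_eq_start hk0, (hA k).dir_eq_start hk0]
    have hik1 := inner1 i k hik
    have hjk1 := inner1 j k hjk
    rw [hkd] at hik1 hjk1
    have hcross := eq_or_eq_of_inner (n0 i) (n0 j) (n1 i) (n1 j) (n0 k) (inner0 i j hij)
      (inner0 i k hik) (inner0 j k hjk) (inner1 i j hij) hik1 hjk1
    refine ⟨(A i).energy + (A j).energy, .inr ⟨A i, A j, ⟨(hA i).isUnit hi, (hA j).isUnit hj, hmi,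
      hmj, .inl ((formAngles_iff (n0 i) (n0 j)).2 ⟨inner0 i j hij, ?_⟩)⟩, rfl⟩, ?_⟩
    · simpa only [neg_neg] using hcross
    · rw [huniv, Finset.sum_insert (by simp [hij, hik]), Finset.sum_insert (by simp [hjk]),
        Finset.sum_singleton] at hsum
      linarith [(hA i).energy_le hi, (hA j).energy_le hj, (hA k).energy_nonneg]

/-- Degenerate Theta-networks converge to degenerate Theta-networks. -/
lemma exists_le_of_degenerate {𝓤 : Ultrafilter ℕ} {D D' : ℕ → Arc} {m : ℝ}
    (hD : ∀ᶠ n in 𝓤, IsDegeneratePair (D n) (D' n))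
    (hm : Tendsto (fun n => (D n).energy + (D' n).energy) 𝓤 (𝓝 m)) :
    ∃ r ∈ energyValues, r ≤ m := by
  obtain ⟨A, e, hA⟩ := Arc.exists_isLimit 𝓤 (D := D) (C := m + 1)
    (hD.mono fun n h => h.isUnit_left) (by
      filter_upwards [hD, hm.eventually_le_const (lt_add_one m)] with n h1 h2
      linarith [h1.isUnit_right.energy_nonneg])
  obtain ⟨B, f, hB⟩ := Arc.exists_isLimit 𝓤 (D := D') (C := m + 1)
    (hD.mono fun n h => h.isUnit_right) (by
      filter_upwards [hD, hm.eventually_le_const (lt_add_one m)] with n h1 h2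
      linarith [h1.isUnit_left.energy_nonneg])
  have hef : e + f = m := tendsto_nhds_unique (hA.tendsto_energy.add hB.tendsto_energy) hm
  have hmA : A.mean = 0 := tendsto_nhds_unique_of_eventuallyEq hA.tendsto_mean
    tendsto_const_nhds (hD.mono fun n h => h.mean_left)
  have hmB : B.mean = 0 := tendsto_nhds_unique_of_eventuallyEq hB.tendsto_mean
    tendsto_const_nhds (hD.mono fun n h => h.mean_right)
  have pA := hA.len_pos_of_mean_eq_zero hmA
  have pB := hB.len_pos_of_mean_eq_zero hmB
  refine ⟨A.energy + B.energy, .inr ⟨A, B, ⟨hA.isUnit pA, hB.isUnit pB, hmA, hmB, ?_⟩, rfl⟩, ?_⟩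
  · rcases Ultrafilter.eventually_or.1 (hD.mono fun n h => h.formAngles) with h | h
    · refine .inl (.of_tendsto (hA.tendsto_dir 0) (hA.tendsto_dir 1).neg (hB.tendsto_dir 0)
        (hB.tendsto_dir 1).neg ?_)
      filter_upwards [h, hD] with n h1 h2
      exact ⟨h2.isUnit_left.2 0 (by simp), h2.isUnit_right.2 0 (by simp), h1⟩
    · refine .inr (.of_tendsto (hA.tendsto_dir 0) (hA.tendsto_dir 1).neg (hB.tendsto_dir 1).neg
        (hB.tendsto_dir 0) ?_)
      filter_upwards [h, hD] with n h1 h2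
      refine ⟨h2.isUnit_left.2 0 (by simp), ?_, h1⟩
      rw [norm_neg]
      exact h2.isUnit_right.2 1 (by simp)
  · linarith [hA.energy_le pA, hB.energy_le pB]

lemma energyValues_nonneg {r : ℝ} (hr : r ∈ energyValues) : 0 ≤ r := by
  rcases hr with ⟨D, hD, rfl⟩ | ⟨A, B, h, rfl⟩
  · exact Finset.sum_nonneg fun i _ => (hD.isUnit i).energy_nonneg
  · exact add_nonneg h.isUnit_left.energy_nonneg h.isUnit_right.energy_nonneg

/-- The direct method, for networks described by arcs. -/
lemma exists_min_energyValues (hne : energyValues.Nonempty) :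
    ∃ m ∈ energyValues, ∀ r ∈ energyValues, m ≤ r := by
  have hbdd : BddBelow energyValues := ⟨0, fun r hr => energyValues_nonneg hr⟩
  obtain ⟨u, -, hu, hmem⟩ := exists_seq_tendsto_sInf hne hbdd
  suffices h : ∃ r ∈ energyValues, r ≤ sInf energyValues by
    obtain ⟨r, hr, hle⟩ := h
    exact ⟨r, hr, fun s hs => hle.trans (csInf_le hbdd hs)⟩
  -- Along an ultrafilter every bounded sequence converges, without passing to subsequences.
  let 𝓤 : Ultrafilter ℕ := hyperfilter ℕ
  have hu' : Tendsto u 𝓤 (𝓝 (sInf energyValues)) := hu.mono_left Nat.hyperfilter_le_atTop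
  rcases Ultrafilter.eventually_or.1 (Eventually.of_forall (f := (𝓤 : Filter ℕ)) hmem) with h | h
  · obtain ⟨D, hD⟩ := skolem.1 h
    exact exists_le_of_theta (hD.mono fun n h => h.1)
      (hu'.congr' (hD.mono fun n h => h.2.symm))
  · obtain ⟨D, hD⟩ := skolem.1 h
    obtain ⟨D', hD'⟩ := skolem.1 hD
    exact exists_le_of_degenerate (hD'.mono fun n h => h.1)
      (hu'.congr' (hD'.mono fun n h => h.2.symm))

/-! ### Networks and arcs -/

/-- The Theta-network with first junction at the origin described by three arcs. -/
noncomputable def thetaNetwork (D : Fin 3 → Arc) (hD : IsThetaTriple D) : H2Network where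
  curve i := (D i).curve
  P₁ := 0
  P₂ := (D 0).curve 1
  isH2 i := (D i).isH2Curve_curve
  start_eq i := (D i).curve_zero
  end_eq i := by rw [Arc.curve_one, Arc.curve_one, hD.chord_eq i 0]
  constant_speed i _ x hx := by
    rw [(hD.isUnit i).norm_velocity hx, (hD.isUnit i).length_curve]

lemma isTheta_thetaNetwork {D : Fin 3 → Arc} (hD : IsThetaTriple D) :
    (thetaNetwork D hD).IsTheta := by
  refine ⟨fun i => (hD.isUnit i).isRegular, fun i j hij => ?_⟩
  have h0 : (0 : ℝ) ∈ Icc (0 : ℝ) 1 := by simp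
  have h1 : (1 : ℝ) ∈ Icc (0 : ℝ) 1 := by simp
  have hi := hD.isUnit i
  have hj := hD.isUnit j
  simp only [thetaNetwork]
  rw [hi.tangent_curve h0, hj.tangent_curve h0, hi.tangent_curve h1, hj.tangent_curve h1,
    angle_eq_iff_inner (hi.2 0 h0) (hj.2 0 h0), angle_eq_iff_inner (hi.2 1 h1) (hj.2 1 h1)]
  exact ⟨hD.inner_zero i j hij, hD.inner_one i j hij⟩

lemma Fbar_thetaNetwork {D : Fin 3 → Arc} (hD : IsThetaTriple D) :
    Fbar (thetaNetwork D hD) = ((∑ i, (D i).energy : ℝ) : EReal) := by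
  rw [Fbar, if_pos (isTheta_thetaNetwork hD)]
  simp only [thetaNetwork, (hD.isUnit _).curveEnergy_curve]

lemma Arc.velocity_default {x : ℝ} (hx : x ∈ Icc (0 : ℝ) 1) :
    velocity (default : Arc).curve x = 0 := by
  rw [Arc.velocity_curve _ hx]
  exact zero_smul _ _

lemma Arc.not_isRegular_default : ¬ IsRegular (default : Arc).curve := fun h =>
  h 0 (by simp) (velocity_default (by simp))

lemma Arc.length_default : length (default : Arc).curve = 0 := by
  rw [length, intervalIntegral.integral_congr (g := fun _ => 0)]
  · simp
  · intro x hx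
    rw [uIcc_of_le zero_le_one] at hx
    simp [velocity_default hx]

/-- The degenerate Theta-network based at the origin described by two arcs, completed by a
constant curve. -/
noncomputable def degenerateNetwork (A B : Arc) (h : IsDegeneratePair A B) : H2Network where
  curve i := ((![A, B, default] : Fin 3 → Arc) i).curve
  P₁ := 0
  P₂ := 0
  isH2 i := Arc.isH2Curve_curve _
  start_eq i := Arc.curve_zero _
  end_eq i := by
    rw [Arc.curve_one]
    fin_cases i
    · simp [h.mean_left]
    · simp [h.mean_right]
    · exact zero_smul _ _
  constant_speed i hi x hx := by
    fin_cases i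
    · exact (h.isUnit_left.norm_velocity hx).trans h.isUnit_left.length_curve.symm
    · exact (h.isUnit_right.norm_velocity hx).trans h.isUnit_right.length_curve.symm
    · exact (Arc.not_isRegular_default hi).elim

lemma isDegenerateTheta_degenerateNetwork {A B : Arc} (h : IsDegeneratePair A B) :
    (degenerateNetwork A B h).IsDegenerateTheta := by
  have h0 : (0 : ℝ) ∈ Icc (0 : ℝ) 1 := by simp
  have h1 : (1 : ℝ) ∈ Icc (0 : ℝ) 1 := by simp
  refine ⟨0, 1, 2, by decide, by decide, by decide, h.isUnit_left.isRegular,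
    h.isUnit_right.isRegular, Arc.length_default, ?_⟩
  change FormAngles (tangent A.curve 0) (-tangent A.curve 1) (tangent B.curve 0)
      (-tangent B.curve 1) ∨
    FormAngles (tangent A.curve 0) (-tangent A.curve 1) (-tangent B.curve 1) (tangent B.curve 0)
  rw [h.isUnit_left.tangent_curve h0, h.isUnit_left.tangent_curve h1,
    h.isUnit_right.tangent_curve h0, h.isUnit_right.tangent_curve h1]
  exact h.formAngles

lemma Fbar_degenerateNetwork {A B : Arc} (h : IsDegeneratePair A B) :
    Fbar (degenerateNetwork A B h) = ((A.energy + B.energy : ℝ) : EReal) := by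
  have h0 : IsRegular ((degenerateNetwork A B h).curve 0) := h.isUnit_left.isRegular
  have h1 : IsRegular ((degenerateNetwork A B h).curve 1) := h.isUnit_right.isRegular
  have h2 : ¬ IsRegular ((degenerateNetwork A B h).curve 2) := Arc.not_isRegular_default
  rw [Fbar, if_neg fun hT => h2 (hT.1 2), if_pos (isDegenerateTheta_degenerateNetwork h),
    Finset.sum_filter, Fin.sum_univ_three, if_pos h0, if_pos h1, if_neg h2, add_zero]
  change ((curveEnergy A.curve + curveEnergy B.curve : ℝ) : EReal) = _
  rw [h.isUnit_left.curveEnergy_curve, h.isUnit_right.curveEnergy_curve]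

/-- Every element of `energyValues` is the value of the functional on a network. -/
lemma exists_network_of_mem {r : ℝ} (hr : r ∈ energyValues) :
    ∃ Γ : H2Network, (Γ.IsTheta ∨ Γ.IsDegenerateTheta) ∧ Fbar Γ = r := by
  rcases hr with ⟨D, hD, rfl⟩ | ⟨A, B, h, rfl⟩
  · exact ⟨_, .inl (isTheta_thetaNetwork hD), Fbar_thetaNetwork hD⟩
  · exact ⟨_, .inr (isDegenerateTheta_degenerateNetwork h), Fbar_degenerateNetwork h⟩

/-- Conversely, the value of the functional on a Theta-network is in `energyValues`. -/
lemma H2Network.IsTheta.exists_Fbar_eq {Γ : H2Network} (h : Γ.IsTheta) :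
    ∃ r ∈ energyValues, Fbar Γ = (r : EReal) := by
  choose D hD hE hdir hchord using fun i =>
    (Γ.isH2 i).exists_arc (h.1 i) (Γ.constant_speed i (h.1 i))
  have h0 : (0 : ℝ) ∈ Icc (0 : ℝ) 1 := by simp
  have h1 : (1 : ℝ) ∈ Icc (0 : ℝ) 1 := by simp
  refine ⟨∑ i, (D i).energy, .inl ⟨D, ⟨hD, fun i j => ?_, fun i j hij => ?_, fun i j hij => ?_⟩,
    rfl⟩, ?_⟩
  · rw [hchord, hchord, Γ.start_eq, Γ.start_eq, Γ.end_eq, Γ.end_eq]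
  · rw [← angle_eq_iff_inner ((hD i).2 0 h0) ((hD j).2 0 h0), hdir i 0 h0, hdir j 0 h0]
    exact (h.2 i j hij).1
  · rw [← angle_eq_iff_inner ((hD i).2 1 h1) ((hD j).2 1 h1), hdir i 1 h1, hdir j 1 h1]
    exact (h.2 i j hij).2
  · simp_rw [Fbar, if_pos h, hE]

lemma IsH2Curve.eq_of_length_eq_zero {γ : ℝ → Plane} (h : IsH2Curve γ) (hl : length γ = 0) :
    γ 1 = γ 0 := by
  obtain ⟨hw, b, hb, h1⟩ := h.exists_primitive
  rw [← sub_eq_zero, ← norm_le_zero_iff, h1]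
  refine (intervalIntegral.norm_integral_le_integral_norm zero_le_one).trans_eq
    ((intervalIntegral.integral_congr fun x hx => ?_).trans hl)
  rw [uIcc_of_le zero_le_one] at hx
  simp only [hb x hx]

lemma H2Network.not_isRegular_of_length_eq_zero (Γ : H2Network) {k : Fin 3}
    (hk : length (Γ.curve k) = 0) : ¬ IsRegular (Γ.curve k) := fun hr => by
  have h := Γ.constant_speed k hr 0 (by simp)
  rw [hk, norm_eq_zero] at h
  exact hr 0 (by simp) h

lemma H2Network.IsDegenerateTheta.exists_Fbar_eq {Γ : H2Network} (h : Γ.IsDegenerateTheta) :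
    ∃ r ∈ energyValues, Fbar Γ = (r : EReal) := by
  have hdeg := h
  obtain ⟨i, j, k, hij, hik, hjk, hi, hj, hk, hang⟩ := h
  have hnk := Γ.not_isRegular_of_length_eq_zero hk
  have hP : Γ.P₂ - Γ.P₁ = 0 := by
    rw [← Γ.end_eq k, ← Γ.start_eq k, (Γ.isH2 k).eq_of_length_eq_zero hk, sub_self]
  obtain ⟨A, hA, hEA, hdA, hcA⟩ := (Γ.isH2 i).exists_arc hi (Γ.constant_speed i hi)
  obtain ⟨B, hB, hEB, hdB, hcB⟩ := (Γ.isH2 j).exists_arc hj (Γ.constant_speed j hj)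
  rw [Γ.end_eq, Γ.start_eq, hP, smul_eq_zero] at hcA hcB
  have h0 : (0 : ℝ) ∈ Icc (0 : ℝ) 1 := by simp
  have h1 : (1 : ℝ) ∈ Icc (0 : ℝ) 1 := by simp
  refine ⟨A.energy + B.energy, .inr ⟨A, B, ⟨hA, hB, hcA.resolve_left hA.1.ne',
    hcB.resolve_left hB.1.ne', ?_⟩, rfl⟩, ?_⟩
  · rwa [hdA 0 h0, hdA 1 h1, hdB 0 h0, hdB 1 h1]
  · have huniv : (Finset.univ : Finset (Fin 3)) = {i, j, k} := by
      clear hnk hi hj hk hang hcA hcB hEA hEB hdA hdB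
      revert i j k
      decide
    rw [Fbar, if_neg fun hT => hnk (hT.1 k), if_pos hdeg, Finset.sum_filter, huniv,
      Finset.sum_insert (by simp [hij, hik]), Finset.sum_insert (by simp [hjk]),
      Finset.sum_singleton, if_pos hi, if_pos hj, if_neg hnk, add_zero, hEA, hEB]

/-! ### A Theta-network -/

/-- A unit tangent field of class `C¹` is that of an arc. -/
lemma exists_arc_of_hasDerivAt {L : ℝ} (hL : 0 < L) {f f' : ℝ → Plane} (hf' : Continuous f')
    (hf : ∀ x, HasDerivAt f (f' x) x) (h1 : ∀ x, ‖f x‖ = 1) :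
    ∃ D : Arc, D.IsUnit ∧ D.len = L ∧ (∀ x ∈ Icc (0 : ℝ) 1, D.dir x = f x) ∧
      D.mean = ∫ x in (0 : ℝ)..1, f x := by
  have hm := memLp_two_of_continuous hf'
  have hdir : ∀ x ∈ Icc (0 : ℝ) 1, (⟨L, f 0, hm.toLp⟩ : Arc).dir x = f x := fun x hx => by
    rw [Arc.dir, primitive_congr _ hm.coeFn_toLp, primitive, intervalIntegral_unitVol _ hx,
      intervalIntegral.integral_eq_sub_of_hasDerivAt (fun y _ => hf y)
        (hf'.intervalIntegrable _ _), add_sub_cancel]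
  refine ⟨⟨L, f 0, hm.toLp⟩, ⟨hL, fun x hx => by rw [hdir x hx, h1]⟩, rfl, hdir, ?_⟩
  refine intervalIntegral.integral_congr fun x hx => ?_
  rw [uIcc_of_le zero_le_one] at hx
  exact hdir x hx

/-- The vector `(u, v)` of the plane. -/
noncomputable def vec (u v : ℝ) : Plane :=
  u • EuclideanSpace.single 0 1 + v • EuclideanSpace.single 1 1

lemma inner_vec (u v u' v' : ℝ) : inner ℝ (vec u v) (vec u' v') = u * u' + v * v' := by
  simp [vec, PiLp.inner_apply, Fin.sum_univ_two, mul_comm]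

lemma norm_vec {u v : ℝ} (h : u ^ 2 + v ^ 2 = 1) : ‖vec u v‖ = 1 := by
  rw [← sq_eq_sq₀ (norm_nonneg _) zero_le_one, ← real_inner_self_eq_norm_sq, inner_vec]
  linarith

lemma hasDerivAt_vec {u v : ℝ → ℝ} {u' v' x : ℝ} (hu : HasDerivAt u u' x)
    (hv : HasDerivAt v v' x) : HasDerivAt (fun x => vec (u x) (v x)) (vec u' v') x :=
  (hu.smul_const _).add (hv.smul_const _)

lemma continuous_vec {u v : ℝ → ℝ} (hu : Continuous u) (hv : Continuous v) :
    Continuous fun x => vec (u x) (v x) :=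
  (hu.smul continuous_const).add (hv.smul continuous_const)

lemma sin_two_pi_div_three : Real.sin (2 * Real.pi / 3) = √3 / 2 := by
  rw [show 2 * Real.pi / 3 = Real.pi - Real.pi / 3 by ring, Real.sin_pi_sub,
    Real.sin_pi_div_three]

/-- The circular arc of radius one and length `4π/3` over a horizontal chord of length `√3`, above
the chord for `σ = 1` and below it for `σ = -1`. -/
lemma exists_circular_arc {σ : ℝ} (hσ : σ ^ 2 = 1) :
    ∃ D : Arc, D.IsUnit ∧ D.dir 0 = vec (-1 / 2) (σ * (√3 / 2)) ∧
      D.dir 1 = vec (-1 / 2) (-(σ * (√3 / 2))) ∧ D.len • D.mean = vec √3 0 := by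
  set k : ℝ := 4 * Real.pi / 3 with hk
  have hk0 : 0 < k := by positivity
  -- The tangent makes the angle `θ` with the chord, up to the sign `σ`.
  set θ : ℝ → ℝ := fun x => 2 * Real.pi / 3 - k * x with hθ
  have hθd : ∀ x, HasDerivAt θ (-k) x := fun x => by
    simpa using ((hasDerivAt_id x).const_mul k).const_sub (2 * Real.pi / 3)
  have hθc : Continuous θ := by fun_prop
  have hcos : ∀ x, HasDerivAt (fun x => Real.cos (θ x)) (k * Real.sin (θ x)) x := fun x => by
    simpa [mul_comm] using (hθd x).cos
  have hsin : ∀ x, HasDerivAt (fun x => Real.sin (θ x)) (-(k * Real.cos (θ x))) x := fun x => by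
    simpa [mul_comm] using (hθd x).sin
  have hθ1 : θ 1 = -(2 * Real.pi / 3) := by simp only [hθ, hk]; ring
  have hθ0 : θ 0 = 2 * Real.pi / 3 := by simp [hθ]
  obtain ⟨D, hD, hlen, hdir, hmean⟩ := exists_arc_of_hasDerivAt hk0
    (f := fun x => vec (Real.cos (θ x)) (σ * Real.sin (θ x)))
    (f' := fun x => vec (k * Real.sin (θ x)) (σ * -(k * Real.cos (θ x))))
    (continuous_vec (by fun_prop) (by fun_prop))
    (fun x => hasDerivAt_vec (hcos x) ((hsin x).const_mul σ))
    (fun x => norm_vec (by rw [mul_pow, hσ, one_mul, Real.cos_sq_add_sin_sq]))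
  refine ⟨D, hD, ?_, ?_, ?_⟩
  · rw [hdir 0 (by simp), hθ0, cos_two_pi_div_three, sin_two_pi_div_three]
  · rw [hdir 1 (by simp), hθ1, Real.cos_neg, Real.sin_neg, cos_two_pi_div_three,
      sin_two_pi_div_three, mul_neg]
  · have hp : ∀ x, HasDerivAt (fun x => vec (-Real.sin (θ x)) (σ * Real.cos (θ x)))
        (k • vec (Real.cos (θ x)) (σ * Real.sin (θ x))) x := fun x => by
      refine (hasDerivAt_vec (u := fun x => -Real.sin (θ x)) (hsin x).neg
        ((hcos x).const_mul σ)).congr_deriv ?_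
      simp only [vec]
      module
    rw [hmean, hlen, ← intervalIntegral.integral_smul,
      intervalIntegral.integral_eq_sub_of_hasDerivAt (fun x _ => hp x)
        (Continuous.intervalIntegrable
          ((continuous_vec (by fun_prop) (by fun_prop)).const_smul k) _ _),
      hθ0, hθ1, Real.cos_neg, Real.sin_neg, cos_two_pi_div_three, sin_two_pi_div_three]
    simp only [vec]
    module

/-- Theta-networks exist: two circular arcs and their common chord. -/
lemma energyValues_nonempty : energyValues.Nonempty := by
  obtain ⟨A, hA, hA0, hA1, hAm⟩ := exists_circular_arc (σ := 1) (by norm_num)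
  obtain ⟨B, hB, hB0, hB1, hBm⟩ := exists_circular_arc (σ := -1) (by norm_num)
  obtain ⟨S, hS, hlen, hdir, hmean⟩ := exists_arc_of_hasDerivAt (L := √3) (by positivity)
    (f := fun _ => vec 1 0) (f' := fun _ => 0) continuous_const
    (fun x => hasDerivAt_const x _) (fun x => norm_vec (by norm_num))
  have hS0 : S.dir 0 = vec 1 0 := hdir 0 (by simp)
  have hS1 : S.dir 1 = vec 1 0 := hdir 1 (by simp)
  have hSm : S.len • S.mean = vec √3 0 := by
    rw [hlen, hmean]
    simp [vec]
  have h3 : √3 * √3 = 3 := Real.mul_self_sqrt (by norm_num)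
  refine ⟨_, .inl ⟨![A, B, S], ⟨?_, ?_, ?_, ?_⟩, rfl⟩⟩
  · intro i
    fin_cases i
    exacts [hA, hB, hS]
  · have : ∀ i : Fin 3, ((![A, B, S] : Fin 3 → Arc) i).len • ((![A, B, S] : Fin 3 → Arc) i).mean
        = vec √3 0 := by
      intro i
      fin_cases i
      exacts [hAm, hBm, hSm]
    intro i j
    rw [this, this]
  · intro i j hij
    fin_cases i <;> fin_cases j <;> first | exact absurd rfl hij | skip
    all_goals
      simp only [Fin.zero_eta, Fin.mk_one, Fin.reduceFinMk, Matrix.cons_val, hA0, hB0, hS0,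
        inner_vec]
      linarith
  · intro i j hij
    fin_cases i <;> fin_cases j <;> first | exact absurd rfl hij | skip
    all_goals
      simp only [Fin.zero_eta, Fin.mk_one, Fin.reduceFinMk, Matrix.cons_val, hA1, hB1, hS1,
        inner_vec]
      linarith

end ThetaNet

theorem mainTheorem6 :
    ∃ Γmin : ThetaNet.H2Network,
      (Γmin.IsTheta ∨ Γmin.IsDegenerateTheta) ∧
      ∀ Γ : ThetaNet.H2Network, ThetaNet.Fbar Γmin ≤ ThetaNet.Fbar Γ := by
  obtain ⟨m, hm, hle⟩ := ThetaNet.exists_min_energyValues ThetaNet.energyValues_nonempty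
  obtain ⟨Γmin, hadm, hF⟩ := ThetaNet.exists_network_of_mem hm
  refine ⟨Γmin, hadm, fun Γ => ?_⟩
  rw [hF]
  by_cases hT : Γ.IsTheta
  · obtain ⟨r, hr, h⟩ := hT.exists_Fbar_eq
    rw [h]
    exact EReal.coe_le_coe_iff.2 (hle r hr)
  by_cases hd : Γ.IsDegenerateTheta
  · obtain ⟨r, hr, h⟩ := hd.exists_Fbar_eq
    rw [h]
    exact EReal.coe_le_coe_iff.2 (hle r hr)
  · rw [ThetaNet.Fbar.eq_def Γ, if_neg hT, if_neg hd]
    exact le_top
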